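/- For $r>0$ write $\Delta_r=\{|\lambda|<r\}$ and $\Delta=\Delta_1$. A \emph{complex one-parameter analytic family of graphs over $\Delta_r$} consists of a two-dimensional complex manifold $\mathcal X$, a holomorphic submersion $\pi:\mathcal X\to\Delta$ all of whose fibres $\mathcal X_\alpha=\pi^{-1}(\alpha)$ are disks (biholomorphic to $\Delta$), and a holomorphic map $\Phi:\mathcal X\to\mathbb C^2$ of generic rank two such that for every $\alpha\in\Delta$ the image $\Phi(\mathcal X_\alpha)$ is the graph $C_\alpha=\{(\lambda,\varphi_\alpha(\lambda)):\lambda\in\Delta_r\}$ of a holomorphic function $\varphi_\alpha:\Delta_r\to\mathbb C$. (For instance $\mathcal X=\Delta_r\times\Delta$, $\pi(\lambda,\alpha)=\alpha$ and $\Phi(\lambda,\alpha)=(\lambda,\varphi_\alpha(\lambda))$, where $\varphi_\alpha(\lambda)$ is holomorphic in $(\lambda,\alpha)$ and not independent of $\alpha$.) Consider the series $$f(\lambda,z)=\sum_{n=1}^{\infty}3^{-4n^3}\prod_{j=1}^{n}\Bigl[z-\bigl(\tfrac23\lambda\bigr)^j\Bigr]\lambda^{-n^2}z^n .$$ (i)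 The series converges normally on compact subsets of $\mathbb C^*\times\mathbb C$, and its sum $f$ is holomorphic on $\mathbb C^*\times\mathbb C$. (ii) For every integer $k\ge1$ the function $\lambda\mapsto f\bigl(\lambda,(\tfrac23\lambda)^k\bigr)$ extends from $\mathbb C^*$ to a holomorphic function on $\mathbb C$; that is, $f$ extends holomorphically along the graph $z=(\tfrac23\lambda)^k$. (iii) For no $r>0$ is there a complex one-parameter analytic family of graphs over $\Delta_r$ with $\varphi_0\equiv0$ such that for every $\alpha\in\Delta$ the function $\lambda\mapsto f(\lambda,\varphi_\alpha(\lambda))$ extends from $\Delta_r\setminus\{0\}$ to a meromorphic function on $\Delta_r$. (In particular this holds for $r=2$ and families of functions $\varphi_\alpha:\Delta_2\to\overline{\Delta}$.) -/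

import Mathlib

open scoped Manifold ContDiff

/-- The `n`-th term `3^{-4n³} ∏_{j=1}^n [z - (2x/3)^j] x^{-n²} zⁿ`, at the point `p = (x, z)`. -/
noncomputable def seriesTerm (n : ℕ) (p : ℂ × ℂ) : ℂ :=
  ((3 : ℂ) ^ (4 * n ^ 3))⁻¹ * (∏ j ∈ Finset.Icc 1 n, (p.2 - (2 / 3 * p.1) ^ j)) *
    (p.1 ^ (n ^ 2))⁻¹ * p.2 ^ n

/-- The sum `f = ∑_{n ≥ 1}` of the series. -/
noncomputable def seriesSum (p : ℂ × ℂ) : ℂ :=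
  ∑' n : ℕ, seriesTerm (n + 1) p

/-- The domain `ℂ* × ℂ`. -/
def ringDomain : Set (ℂ × ℂ) := {p | p.1 ≠ 0}

/-- The restriction of `f` (a function on `ℂ* × ℂ`) to the graph `z = φ(x)`, `x ∈ U`, `x ≠ 0`,
extends to a holomorphic function on the whole graph over `U`. -/
def ExtendsHolomorphicallyAlong (f : ℂ × ℂ → ℂ) (U : Set ℂ) (φ : ℂ → ℂ) : Prop :=
  ∃ g : ℂ → ℂ, DifferentiableOn ℂ g U ∧ ∀ x ∈ U, x ≠ 0 → g x = f (x, φ x)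

/-- The restriction of `f` (a function on `ℂ* × ℂ`) to the graph `z = φ(x)`, `x ∈ U`, `x ≠ 0`,
extends to a meromorphic function on the whole graph over `U`. -/
def ExtendsMeromorphicallyAlong (f : ℂ × ℂ → ℂ) (U : Set ℂ) (φ : ℂ → ℂ) : Prop :=
  ∃ g : ℂ → ℂ, MeromorphicOn g U ∧ ∀ x ∈ U, x ≠ 0 → g x = f (x, φ x)

/-- A complex one-parameter analytic family `(X, π, Δ, Φ)` of graphs over the disk `Δ_r`:
`X` is a complex surface, `π` is a holomorphic submersion of `X` onto the unit disk `Δ` whose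
fibres are disks, and `Φ : X → ℂ²` is a holomorphic map of generic rank two which maps the fibre
over `α` onto the graph of a holomorphic function `φ α` on `Δ_r`.

The basic example is `X = Δ_r × Δ`, `π (x, α) = α`, `Φ (x, α) = (x, φ α x)`, where `φ α x` is
holomorphic in `(x, α)` and does depend on `α`. -/
structure IsOneParameterFamily (r : ℝ) (X : Type*) [TopologicalSpace X]
    [ChartedSpace (ℂ × ℂ) X] (π : X → ℂ) (Φ : X → ℂ × ℂ) (φ : ℂ → ℂ → ℂ) : Prop where
  mapsTo : ∀ x, π x ∈ Metric.ball (0 : ℂ) 1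
  holomorphic_proj : ContMDiff 𝓘(ℂ, ℂ × ℂ) 𝓘(ℂ, ℂ) ω π
  submersion : ∀ x, Function.Surjective (mfderiv 𝓘(ℂ, ℂ × ℂ) 𝓘(ℂ, ℂ) π x)
  /-- Each fibre is the bijective holomorphic image of the unit disk (and hence, being a
  one-dimensional complex submanifold, biholomorphic to it). -/
  fibre_disk : ∀ α ∈ Metric.ball (0 : ℂ) 1, ∃ e : ℂ → X,
    ContMDiffOn 𝓘(ℂ, ℂ) 𝓘(ℂ, ℂ × ℂ) ω e (Metric.ball 0 1) ∧
      Set.BijOn e (Metric.ball 0 1) (π ⁻¹' {α})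
  holomorphic_map : ContMDiff 𝓘(ℂ, ℂ × ℂ) 𝓘(ℂ, ℂ × ℂ) ω Φ
  /-- Generic rank two: the rank is two somewhere, hence outside a proper analytic subset of the
  connected manifold `X`. -/
  generic_rank : ∃ x, Function.Surjective (mfderiv 𝓘(ℂ, ℂ × ℂ) 𝓘(ℂ, ℂ × ℂ) Φ x)
  holomorphic_graph : ∀ α ∈ Metric.ball (0 : ℂ) 1, DifferentiableOn ℂ (φ α) (Metric.ball 0 r)
  image_fibre : ∀ α ∈ Metric.ball (0 : ℂ) 1,
    Φ '' (π ⁻¹' {α}) = {p | p.1 ∈ Metric.ball (0 : ℂ) r ∧ p.2 = φ α p.1}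

open Filter Topology

/-! The factor `81^(-n³)` beats every power `S^(n²)`, which gives normal convergence. Let `φ` be
holomorphic near `0`, of vanishing order `l`, and not one of the graphs `0` or `(2x/3)^k`. No term
vanishes identically along `φ`, and the quotient of terms `m + 1` and `m` has size about
`3^(-4(3m²+3m+1)) |x|^(2l-2m-1)`. So the pole orders grow without bound, and on `|x| = 3^(-6(n+l))`
the quotient passes from large to small exactly at `m = n`: term `n` dominates the tail. As `n → ∞`
the sum outgrows every power of `1/|x|`, so the singularity is essential
(`not_meromorphicAt_seriesSum`). Hence meromorphic extension is possible along only countably many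
graphs (`eqOn_of_extendsMeromorphicallyAlong`), whereas a family of generic rank two sweeps out an
open set (`ContMDiff.range_mem_nhds`), whose vertical slices are uncountable. -/

/-! ### Normal convergence and holomorphy of the sum -/

theorem seriesTerm_norm_le {R : ℝ} (hR : 1 ≤ R) {p : ℂ × ℂ} (h1 : ‖p.1‖ ≤ R) (h2 : ‖p.2‖ ≤ R)
    (h3 : ‖p.1‖⁻¹ ≤ R) (n : ℕ) :
    ‖seriesTerm n p‖ ≤ (2 * R ^ 3) ^ (n ^ 2) / 81 ^ (n ^ 3) := by
  have hR0 : 0 ≤ R := by linarith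
  have hprod : ‖∏ j ∈ Finset.Icc 1 n, (p.2 - (2 / 3 * p.1) ^ j)‖ ≤ (2 * R ^ n) ^ n := by
    rw [norm_prod]
    calc _ ≤ ∏ j ∈ Finset.Icc 1 n, (2 * R ^ n) := by
          refine Finset.prod_le_prod (fun _ _ => norm_nonneg _) fun j hj => ?_
          rw [Finset.mem_Icc] at hj
          have hx : ‖2 / 3 * p.1‖ ≤ R := by
            rw [norm_mul]
            have : ‖(2 / 3 : ℂ)‖ ≤ 1 := by norm_num
            nlinarith [norm_nonneg p.1]
          calc _ ≤ ‖p.2‖ + ‖(2 / 3 * p.1) ^ j‖ := norm_sub_le _ _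
            _ ≤ R ^ n + R ^ n := by
              rw [norm_pow]
              refine add_le_add (h2.trans (le_self_pow₀ hR (by omega))) ?_
              exact (pow_le_pow_left₀ (norm_nonneg _) hx j).trans (pow_le_pow_right₀ hR hj.2)
            _ = _ := by ring
      _ = _ := by simp
  have h81 : ((81 : ℝ) ^ (n ^ 3)) = 3 ^ (4 * n ^ 3) := by
    rw [pow_mul]; norm_num
  rw [seriesTerm, norm_mul, norm_mul, norm_mul, norm_inv, norm_inv, norm_pow, norm_pow, norm_pow,
    h81, div_eq_inv_mul ((2 * R ^ 3) ^ (n ^ 2)), mul_assoc, mul_assoc, ← inv_pow ‖p.1‖]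
  simp only [Complex.norm_ofNat]
  refine mul_le_mul_of_nonneg_left ?_ (by positivity)
  have h2n : (2 : ℝ) ^ n ≤ 2 ^ (n ^ 2) :=
    pow_le_pow_right₀ (by norm_num) (Nat.le_self_pow (by norm_num) n)
  calc _ ≤ (2 * R ^ n) ^ n * (R ^ (n ^ 2) * R ^ n) := by
        gcongr
    _ ≤ (2 * R ^ n) ^ n * (R ^ (n ^ 2) * R ^ (n ^ 2)) := by
        gcongr
        · exact Nat.le_self_pow (by norm_num) n
    _ = 2 ^ n * (R ^ 3) ^ (n ^ 2) := by ring
    _ ≤ 2 ^ (n ^ 2) * (R ^ 3) ^ (n ^ 2) := by gcongr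
    _ = _ := by ring

theorem summable_pow_sq_div_pow_cube (S : ℝ) (hS : 0 ≤ S) :
    Summable fun n : ℕ => S ^ (n ^ 2) / 81 ^ (n ^ 3) := by
  refine Summable.of_norm_bounded_eventually_nat (g := fun n => (1 / 2 : ℝ) ^ n)
    (summable_geometric_of_lt_one (by norm_num) (by norm_num)) ?_
  have ht := tendsto_pow_atTop_nhds_zero_of_lt_one (r := (1 / 81 : ℝ)) (by norm_num) (by norm_num)
  have ht := ht.const_mul S
  rw [mul_zero] at ht
  filter_upwards [ht.eventually_le_const (show (0 : ℝ) < 1 / 2 by norm_num)] with n hn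
  rw [Real.norm_of_nonneg (by positivity)]
  -- As a power with exponent `n²`, the base `S · 81^(-n)` is eventually at most `1/2`.
  have : S ^ (n ^ 2) / 81 ^ (n ^ 3) = (S * (1 / 81) ^ n) ^ (n ^ 2) := by
    rw [mul_pow, ← pow_mul, one_div, inv_pow, div_eq_mul_inv]
    congr 3
    ring
  rw [this]
  calc _ ≤ (1 / 2 : ℝ) ^ (n ^ 2) := pow_le_pow_left₀ (by positivity) hn _
    _ ≤ _ := pow_le_pow_of_le_one (by norm_num) (by norm_num) (Nat.le_self_pow (by norm_num) n)

theorem seriesTerm_normal_convergence (K : Set (ℂ × ℂ)) (hK : IsCompact K) (hKr : K ⊆ ringDomain) :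
    ∃ u : ℕ → ℝ, Summable u ∧ ∀ n : ℕ, ∀ p ∈ K, ‖seriesTerm (n + 1) p‖ ≤ u n := by
  obtain ⟨A, hA⟩ := hK.exists_bound_of_continuousOn (f := fun p : ℂ × ℂ => p) continuousOn_id
  obtain ⟨B, hB⟩ := hK.exists_bound_of_continuousOn (f := fun p : ℂ × ℂ => p.1⁻¹)
    (continuous_fst.continuousOn.inv₀ fun p hp => hKr hp)
  set R := max 1 (max A B)
  have hRA : A ≤ R := (le_max_left _ _).trans (le_max_right _ _)
  have hRB : B ≤ R := (le_max_right _ _).trans (le_max_right _ _)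
  have hR : 1 ≤ R := le_max_left _ _
  refine ⟨fun n => (2 * R ^ 3) ^ ((n + 1) ^ 2) / 81 ^ ((n + 1) ^ 3),
    (summable_nat_add_iff (f := fun n => (2 * R ^ 3) ^ (n ^ 2) / 81 ^ (n ^ 3)) 1).2
      (summable_pow_sq_div_pow_cube _ (by positivity)), fun n p hp => ?_⟩
  refine seriesTerm_norm_le hR ?_ ?_ ?_ _
  · exact (norm_fst_le p).trans ((hA p hp).trans hRA)
  · exact (norm_snd_le p).trans ((hA p hp).trans hRA)
  · rw [← norm_inv]; exact (hB p hp).trans hRB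

theorem isOpen_ringDomain : IsOpen ringDomain :=
  isOpen_ne.preimage continuous_fst

theorem differentiableAt_seriesTerm (n : ℕ) {p : ℂ × ℂ} (hp : p ∈ ringDomain) :
    DifferentiableAt ℂ (seriesTerm n) p := by
  have hp : p.1 ^ (n ^ 2) ≠ 0 := pow_ne_zero _ hp
  unfold seriesTerm
  fun_prop (disch := assumption)

theorem summable_seriesTerm {p : ℂ × ℂ} (hp : p ∈ ringDomain) :
    Summable fun n => seriesTerm (n + 1) p := by
  obtain ⟨u, hu, hb⟩ := seriesTerm_normal_convergence {p} isCompact_singleton (by simpa using hp)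
  exact Summable.of_norm_bounded hu fun n => hb n p rfl

/-- A series of holomorphic functions on a finite-dimensional space which converges normally on
compact subsets of an open set has a holomorphic sum. -/
theorem differentiableOn_tsum_of_normal_convergence {E : Type*} [NormedAddCommGroup E]
    [NormedSpace ℂ E] [ProperSpace E] {U : Set E} (hU : IsOpen U) {F : ℕ → E → ℂ}
    (hF : ∀ n, DifferentiableOn ℂ (F n) U)
    (hb : ∀ K, IsCompact K → K ⊆ U → ∃ u : ℕ → ℝ, Summable u ∧ ∀ n, ∀ p ∈ K, ‖F n p‖ ≤ u n) :
    DifferentiableOn ℂ (fun p => ∑' n, F n p) U := by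
  intro p hp
  obtain ⟨ε, hε, hεU⟩ := Metric.nhds_basis_closedBall.mem_iff.1 (hU.mem_nhds hp)
  obtain ⟨u, hu, hub⟩ := hb _ (isCompact_closedBall p ε) hεU
  let _ : NormedSpace ℝ E := NormedSpace.restrictScalars ℝ ℂ E
  have hsub : ∀ q ∈ Metric.ball p (ε / 2), Metric.ball q (ε / 2) ⊆ Metric.closedBall p ε := by
    intro q hq
    refine (Metric.ball_subset_ball' ?_).trans Metric.ball_subset_closedBall
    have := Metric.mem_ball.1 hq
    linarith
  have hmem : ∀ q ∈ Metric.ball p (ε / 2), q ∈ Metric.closedBall p ε := fun q hq =>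
    hsub q hq (Metric.mem_ball_self (by positivity))
  -- The derivative bound is Cauchy's estimate: on a ball of radius `ε / 2` about `q`, `F n` stays
  -- within `2 * u n` of `F n q`.
  refine (hasFDerivAt_tsum_of_isPreconnected (f := F) (f' := fun n q => fderiv ℂ (F n) q)
    (u := fun n => 2 * u n / (ε / 2)) (x₀ := p) (s := Metric.ball p (ε / 2)) ?_ Metric.isOpen_ball
    (convex_ball p (ε / 2)).isPreconnected ?_ ?_ (Metric.mem_ball_self (by positivity)) ?_
    (Metric.mem_ball_self (by positivity))).differentiableAt.differentiableWithinAt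
  · exact (hu.mul_left 2).div_const _
  · intro n q hq
    exact ((hF n).differentiableAt (hU.mem_nhds (hεU (hmem q hq)))).hasFDerivAt
  · intro n q hq
    refine Complex.norm_fderiv_le_div_of_mapsTo_ball
      ((hF n).mono ((hsub q hq).trans hεU)) ?_ (by positivity)
    intro y hy
    rw [mem_closedBall_iff_norm]
    calc _ ≤ ‖F n y‖ + ‖F n q‖ := norm_sub_le _ _
      _ ≤ u n + u n := add_le_add (hub n y (hsub q hq hy)) (hub n q (hmem q hq))
      _ = _ := by ring
  · exact Summable.of_norm_bounded hu fun n => hub n p (Metric.mem_closedBall_self hε.le)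

theorem differentiableOn_seriesSum : DifferentiableOn ℂ seriesSum ringDomain :=
  differentiableOn_tsum_of_normal_convergence isOpen_ringDomain
    (fun n _ hp => (differentiableAt_seriesTerm (n + 1) hp).differentiableWithinAt)
    seriesTerm_normal_convergence

/-- Along `z = (2x/3)^k` only the terms with `n < k` survive, and they have no pole. -/
theorem seriesSum_extends_along_pow (k : ℕ) (hk : 1 ≤ k) :
    ExtendsHolomorphicallyAlong seriesSum Set.univ (fun x => (2 / 3 * x) ^ k) := by
  have hsum : ∀ x : ℂ, seriesSum (x, (2 / 3 * x) ^ k) =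
      ∑ n ∈ Finset.range (k - 1), seriesTerm (n + 1) (x, (2 / 3 * x) ^ k) := by
    intro x
    refine tsum_eq_sum fun n hn => ?_
    rw [Finset.mem_range] at hn
    have : ∏ j ∈ Finset.Icc 1 (n + 1), ((2 / 3 * x) ^ k - (2 / 3 * x) ^ j) = 0 :=
      Finset.prod_eq_zero (i := k) (Finset.mem_Icc.2 ⟨hk, by omega⟩) (sub_self _)
    simp [seriesTerm, this]
  have hterm : ∀ n < k, ∃ g : ℂ → ℂ, Differentiable ℂ g ∧
      ∀ x, x ≠ 0 → g x = seriesTerm n (x, (2 / 3 * x) ^ k) := by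
    intro n hn
    -- Since `n < k`, the zero of `zⁿ` of order `k * n` absorbs the pole of order `n²`.
    refine ⟨fun x => ((3 : ℂ) ^ (4 * n ^ 3))⁻¹ *
      (∏ j ∈ Finset.Icc 1 n, ((2 / 3 * x) ^ k - (2 / 3 * x) ^ j)) *
        ((2 / 3) ^ (k * n) * x ^ (k * n - n ^ 2)), ?_, ?_⟩
    · fun_prop
    · intro x hx
      have h : n ^ 2 ≤ k * n := by nlinarith
      have : (2 / 3 : ℂ) ^ (k * n) * x ^ (k * n - n ^ 2) =
          (x ^ (n ^ 2))⁻¹ * ((2 / 3 * x) ^ k) ^ n := by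
        rw [← pow_mul, mul_pow, pow_sub₀ x hx h]; ring
      simp only [seriesTerm, this]
      ring
  choose! g hg hgeq using hterm
  refine ⟨fun x => ∑ n ∈ Finset.range (k - 1), g (n + 1) x, ?_, ?_⟩
  · refine Differentiable.differentiableOn (Differentiable.fun_sum fun n hn => ?_)
    rw [Finset.mem_range] at hn
    exact hg _ (by omega)
  · intro x _ hx
    rw [hsum]
    refine Finset.sum_congr rfl fun n hn => ?_
    rw [Finset.mem_range] at hn
    exact hgeq _ (by omega) x hx

/-! ### Domination by a peak term -/

/-- If the terms of a series grow geometrically up to the index `n` and decay geometrically from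
there on, then the `n`-th term dominates the sum. -/
theorem norm_le_three_mul_norm_tsum_of_peak {t : ℕ → ℂ} {n : ℕ}
    (hup : ∀ m < n, 4 * ‖t m‖ ≤ ‖t (m + 1)‖) (hdown : ∀ m, n ≤ m → 4 * ‖t (m + 1)‖ ≤ ‖t m‖) :
    ‖t n‖ ≤ 3 * ‖∑' m, t m‖ := by
  -- With ratio `4`, the terms before the peak and those after it each contribute at most a third of
  -- the peak, so a third of it survives.
  have hhead : ∀ k ≤ n, ∑ m ∈ Finset.range k, ‖t m‖ ≤ ‖t k‖ / 3 := by
    intro k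
    induction k with
    | zero => intro _; simp; positivity
    | succ k ih =>
      intro hk
      rw [Finset.sum_range_succ]
      have := ih (by omega)
      have := hup k (by omega)
      linarith
  have hdec : ∀ k, ‖t (k + n)‖ ≤ ‖t n‖ * (1 / 4) ^ k := by
    intro k
    induction k with
    | zero => simp
    | succ k ih =>
      have := hdown (k + n) (by omega)
      rw [pow_succ, show k + 1 + n = k + n + 1 by ring]
      linarith
  have hgeo : Summable fun k : ℕ => ‖t n‖ * (1 / 4 : ℝ) ^ k :=
    (summable_geometric_of_lt_one (by norm_num) (by norm_num)).mul_left _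
  have hs : Summable t := (summable_nat_add_iff n).1 (Summable.of_norm_bounded hgeo hdec)
  have htail : ‖∑' k, t (k + (n + 1))‖ ≤ ‖t n‖ / 3 := by
    have hg : HasSum (fun k : ℕ => ‖t n‖ / 4 * (1 / 4 : ℝ) ^ k) (‖t n‖ / 4 * (1 - 1 / 4)⁻¹) :=
      (hasSum_geometric_of_lt_one (by norm_num) (by norm_num)).mul_left _
    refine (tsum_of_norm_bounded hg fun k => ?_).trans_eq (by ring)
    have := hdec (k + 1)
    rw [pow_succ] at this
    rw [show k + (n + 1) = k + 1 + n by ring]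
    linarith
  have hsplit := hs.sum_add_tsum_nat_add (n + 1)
  rw [Finset.sum_range_succ] at hsplit
  have hh : ‖∑ m ∈ Finset.range n, t m‖ ≤ ‖t n‖ / 3 := (norm_sum_le _ _).trans (hhead n le_rfl)
  have heq : t n = ∑' m, t m - ∑ m ∈ Finset.range n, t m - ∑' k, t (k + (n + 1)) := by
    rw [← hsplit]; ring
  have : ‖t n‖ ≤ ‖∑' m, t m‖ + ‖∑ m ∈ Finset.range n, t m‖ + ‖∑' k, t (k + (n + 1))‖ := by
    conv_lhs => rw [heq]
    exact (norm_sub_le _ _).trans (add_le_add_left (norm_sub_le _ _) _)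
  linarith

/-! ### Orders of vanishing and quotients of consecutive terms -/

theorem AnalyticAt.exists_norm_bounds {h : ℂ → ℂ} (hh : AnalyticAt ℂ h 0)
    (hne : ¬ ∀ᶠ x in 𝓝 0, h x = 0) :
    ∃ (l : ℕ) (κ K : ℝ), 0 < κ ∧ 0 < K ∧
      ∀ᶠ x in 𝓝 0, κ * ‖x‖ ^ l ≤ ‖h x‖ ∧ ‖h x‖ ≤ K * ‖x‖ ^ l := by
  obtain ⟨l, g, hg, hg0, heq⟩ := hh.exists_eventuallyEq_pow_smul_nonzero_iff.2 hne
  have hpos : 0 < ‖g 0‖ := norm_pos_iff.2 hg0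
  have hc : Tendsto (fun x => ‖g x‖) (𝓝 0) (𝓝 ‖g 0‖) := hg.continuousAt.norm
  refine ⟨l, ‖g 0‖ / 2, ‖g 0‖ * 2, by positivity, by positivity, ?_⟩
  filter_upwards [heq, hc.eventually_const_le (show ‖g 0‖ / 2 < ‖g 0‖ by linarith),
    hc.eventually_le_const (show ‖g 0‖ < ‖g 0‖ * 2 by linarith)] with x hx h1 h2
  rw [hx, sub_zero, norm_smul, norm_pow, mul_comm (‖x‖ ^ l)]
  exact ⟨by gcongr, by gcongr⟩

/-- `h` vanishes at most to finite order at `0`, in the sense of a power lower bound. -/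
def HasPowerLowerBound (h : ℂ → ℂ) : Prop :=
  ∃ (C : ℝ) (A : ℕ), 0 < C ∧ ∀ᶠ x in 𝓝 0, C * ‖x‖ ^ A ≤ ‖h x‖

theorem HasPowerLowerBound.mul {f g : ℂ → ℂ} (hf : HasPowerLowerBound f)
    (hg : HasPowerLowerBound g) : HasPowerLowerBound (f * g) := by
  obtain ⟨C, A, hC, h1⟩ := hf
  obtain ⟨D, B, hD, h2⟩ := hg
  refine ⟨C * D, A + B, by positivity, ?_⟩
  filter_upwards [h1, h2] with x h1 h2
  rw [Pi.mul_apply, norm_mul, pow_add]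
  calc _ = (C * ‖x‖ ^ A) * (D * ‖x‖ ^ B) := by ring
    _ ≤ _ := by gcongr

theorem HasPowerLowerBound.const {c : ℂ} (hc : c ≠ 0) : HasPowerLowerBound fun _ => c :=
  ⟨‖c‖, 0, norm_pos_iff.2 hc, by simp⟩

theorem HasPowerLowerBound.prod {ι : Type*} (s : Finset ι) {f : ι → ℂ → ℂ}
    (hf : ∀ i ∈ s, HasPowerLowerBound (f i)) : HasPowerLowerBound (∏ i ∈ s, f i) :=
  Finset.prod_induction f HasPowerLowerBound (fun _ _ => HasPowerLowerBound.mul)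
    (HasPowerLowerBound.const one_ne_zero) hf

theorem AnalyticAt.hasPowerLowerBound {h : ℂ → ℂ} (hh : AnalyticAt ℂ h 0)
    (hne : ¬ ∀ᶠ x in 𝓝 0, h x = 0) : HasPowerLowerBound h := by
  obtain ⟨l, κ, _, hκ, _, h⟩ := hh.exists_norm_bounds hne
  exact ⟨κ, l, hκ, h.mono fun x hx => hx.1⟩

theorem seriesTerm_succ (m : ℕ) (p : ℂ × ℂ) :
    seriesTerm (m + 1) p = seriesTerm m p * (((3 : ℂ) ^ (4 * (3 * m ^ 2 + 3 * m + 1)))⁻¹ *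
      (p.1 ^ (2 * m + 1))⁻¹ * (p.2 * (p.2 - (2 / 3 * p.1) ^ (m + 1)))) := by
  rw [seriesTerm, seriesTerm, Finset.prod_Icc_succ_top (by omega),
    show 4 * (m + 1) ^ 3 = 4 * m ^ 3 + 4 * (3 * m ^ 2 + 3 * m + 1) by ring,
    show (m + 1) ^ 2 = m ^ 2 + (2 * m + 1) by ring, pow_add 3, pow_add p.1 (m ^ 2), mul_inv,
    mul_inv]
  ring

/-- The size of the quotient of consecutive terms along a graph of vanishing order `l`. -/
noncomputable def termRatio (l m : ℕ) (ρ : ℝ) : ℝ :=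
  (3 ^ (4 * (3 * m ^ 2 + 3 * m + 1)))⁻¹ * (ρ ^ (2 * m + 1))⁻¹ * ρ ^ (2 * l)

theorem termRatio_add {l i : ℕ} {ρ : ℝ} (hρ : 0 < ρ) :
    termRatio l (l + i) ρ =
      (3 ^ (4 * (3 * (l + i) ^ 2 + 3 * (l + i) + 1)))⁻¹ * (ρ ^ (2 * i + 1))⁻¹ := by
  rw [termRatio, show 2 * (l + i) + 1 = (2 * i + 1) + 2 * l by ring, pow_add ρ]
  field_simp

/-- For `m = l + i` and this radius, `termRatio` is a power of `3` with exponent `6(n+l)(2i+1) -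
4(3m²+3m+1)`. It increases with `n`, equals `-(6i+12l²+4)` at `n = m`, and equals `6i-12l²+2` at `n
= m + 1`; this also accounts for the condition on `i` in `le_termRatio_peak`. -/
theorem termRatio_peak_le {l i n : ℕ} (h : n ≤ l + i) :
    termRatio l (l + i) (3 ^ (6 * (n + l)))⁻¹ ≤ (3 ^ i)⁻¹ := by
  rw [termRatio_add (by positivity), inv_pow, inv_inv, ← pow_mul,
    inv_mul_le_iff₀ (by positivity), ← div_eq_mul_inv, le_div_iff₀ (by positivity), ← pow_add]
  refine pow_le_pow_right₀ (by norm_num) ?_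
  nlinarith [Nat.zero_le (l * i), Nat.zero_le (l ^ 2),
    Nat.mul_le_mul_right (2 * i + 1) h]

theorem le_termRatio_peak {l i n : ℕ} (h : l + i < n) (hi : 12 * l ^ 2 ≤ i) :
    3 ^ i ≤ termRatio l (l + i) (3 ^ (6 * (n + l)))⁻¹ := by
  rw [termRatio_add (by positivity), inv_pow, inv_inv, ← pow_mul,
    le_inv_mul_iff₀ (by positivity), ← pow_add]
  refine pow_le_pow_right₀ (by norm_num) ?_
  nlinarith [Nat.zero_le (l * i), Nat.zero_le (l ^ 2),
    Nat.mul_le_mul_right (2 * i + 1) (Nat.succ_le_of_lt h)]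

/-- The power of `ρ` in the quotient is `-(2(m-l)+1) ≤ -1`, so each step from `m ≥ l` on gains at
least one pole order. -/
theorem le_mul_termRatio {l m : ℕ} (h : l ≤ m) {ρ : ℝ} (hρ : 0 < ρ) (hρ1 : ρ ≤ 1) :
    (3 ^ (4 * (3 * m ^ 2 + 3 * m + 1)))⁻¹ ≤ ρ * termRatio l m ρ := by
  obtain ⟨i, rfl⟩ := Nat.exists_eq_add_of_le h
  rw [termRatio_add hρ, pow_succ ρ, mul_inv]
  have : 1 ≤ (ρ ^ (2 * i))⁻¹ := one_le_inv_iff₀.2 ⟨by positivity, pow_le_one₀ hρ.le hρ1⟩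
  calc _ ≤ ((3 : ℝ) ^ (4 * (3 * (l + i) ^ 2 + 3 * (l + i) + 1)))⁻¹ * (ρ ^ (2 * i))⁻¹ :=
        le_mul_of_one_le_right (by positivity) this
    _ = _ := by field_simp

/-- Uniform two-sided bounds for the quotients of consecutive terms. -/
theorem seriesTerm_ratio_bounds {φ : ℂ → ℂ} {l : ℕ} {κ K : ℝ} (hκ : 0 < κ)
    (hφ : ∀ᶠ x in 𝓝 0, κ * ‖x‖ ^ l ≤ ‖φ x‖ ∧ ‖φ x‖ ≤ K * ‖x‖ ^ l) :
    ∀ᶠ x in 𝓝 0, ∀ m, l ≤ m →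
      κ ^ 2 / 2 * termRatio l m ‖x‖ * ‖seriesTerm m (x, φ x)‖ ≤ ‖seriesTerm (m + 1) (x, φ x)‖ ∧
      ‖seriesTerm (m + 1) (x, φ x)‖ ≤
        K * (K + 1) * termRatio l m ‖x‖ * ‖seriesTerm m (x, φ x)‖ := by
  have hn : Tendsto (fun x : ℂ => ‖x‖) (𝓝 0) (𝓝 0) := by
    simpa using (continuous_norm (E := ℂ)).tendsto 0
  filter_upwards [hφ, hn.eventually_le_const one_pos,
    hn.eventually_le_const (half_pos hκ)] with x ⟨h1, h2⟩ hx1 hxκ m hm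
  -- Since `m ≥ l`, this power is smaller than `φ` by a factor of order `|x|`, so subtracting it
  -- costs at most half of `κ`.
  have hpow : ‖(2 / 3 * x) ^ (m + 1)‖ ≤ ‖x‖ * ‖x‖ ^ l := by
    rw [norm_pow, norm_mul, ← pow_succ']
    calc _ ≤ ‖x‖ ^ (m + 1) := by
          gcongr
          have : ‖(2 / 3 : ℂ)‖ ≤ 1 := by norm_num
          nlinarith [norm_nonneg x]
      _ ≤ _ := pow_le_pow_of_le_one (norm_nonneg _) hx1 (by omega)
  have hl : 0 ≤ ‖x‖ ^ l := by positivity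
  have hlow : κ / 2 * ‖x‖ ^ l ≤ ‖φ x - (2 / 3 * x) ^ (m + 1)‖ := by
    have := norm_sub_norm_le (φ x) ((2 / 3 * x) ^ (m + 1))
    nlinarith
  have hupp : ‖φ x - (2 / 3 * x) ^ (m + 1)‖ ≤ (K + 1) * ‖x‖ ^ l := by
    have := norm_sub_le (φ x) ((2 / 3 * x) ^ (m + 1))
    nlinarith
  have hnorm : ‖seriesTerm (m + 1) (x, φ x)‖ =
      (3 ^ (4 * (3 * m ^ 2 + 3 * m + 1)))⁻¹ * (‖x‖ ^ (2 * m + 1))⁻¹ * ‖seriesTerm m (x, φ x)‖ *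
        (‖φ x‖ * ‖φ x - (2 / 3 * x) ^ (m + 1)‖) := by
    rw [seriesTerm_succ]
    simp only [norm_mul, norm_inv, norm_pow, Complex.norm_ofNat]
    ring
  rw [hnorm, termRatio]
  have hφ0 : 0 ≤ K * ‖x‖ ^ l := (norm_nonneg _).trans h2
  constructor
  · calc _ = (3 ^ (4 * (3 * m ^ 2 + 3 * m + 1)))⁻¹ * (‖x‖ ^ (2 * m + 1))⁻¹ *
          ‖seriesTerm m (x, φ x)‖ * ((κ * ‖x‖ ^ l) * (κ / 2 * ‖x‖ ^ l)) := by ring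
      _ ≤ _ := by gcongr
  · calc _ ≤ (3 ^ (4 * (3 * m ^ 2 + 3 * m + 1)))⁻¹ * (‖x‖ ^ (2 * m + 1))⁻¹ *
          ‖seriesTerm m (x, φ x)‖ * ((K * ‖x‖ ^ l) * ((K + 1) * ‖x‖ ^ l)) := by gcongr
      _ = _ := by ring

/-! ### Essential singularity along all other graphs -/

theorem eventually_norm_lt_one : ∀ᶠ x : ℂ in 𝓝 0, ‖x‖ < 1 := by
  filter_upwards [Metric.ball_mem_nhds (0 : ℂ) one_pos] with x hx
  simpa using hx

/-- The hypotheses say that no factor vanishes identically, so each has finite order at `0`; the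
factor `x^(-m²)` only helps when `|x| < 1`. -/
theorem seriesTerm_hasPowerLowerBound {φ : ℂ → ℂ} (hφ : AnalyticAt ℂ φ 0)
    (h0 : ¬ ∀ᶠ x in 𝓝 0, φ x = 0)
    (hk : ∀ k : ℕ, 1 ≤ k → ¬ ∀ᶠ x in 𝓝 0, φ x = (2 / 3 * x) ^ k) (m : ℕ) :
    ∃ (C : ℝ) (A : ℕ), 0 < C ∧
      ∀ᶠ x in 𝓝[≠] 0, C * ‖x‖ ^ A ≤ ‖seriesTerm m (x, φ x)‖ := by
  have hprod : HasPowerLowerBound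
      ((fun _ => ((3 : ℂ) ^ (4 * m ^ 3))⁻¹) *
        (∏ j ∈ Finset.Icc 1 m, fun x => φ x - (2 / 3 * x) ^ j) *
        ∏ _j ∈ Finset.range m, φ) := by
    refine ((HasPowerLowerBound.const (by simp)).mul (HasPowerLowerBound.prod _ ?_)).mul
      (HasPowerLowerBound.prod _ fun _ _ => hφ.hasPowerLowerBound h0)
    intro j hj
    refine AnalyticAt.hasPowerLowerBound (by fun_prop) fun h => ?_
    exact hk j (Finset.mem_Icc.1 hj).1 (h.mono fun x hx => sub_eq_zero.1 hx)
  obtain ⟨C, A, hC, h⟩ := hprod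
  have hn := eventually_norm_lt_one
  refine ⟨C, A, hC, ?_⟩
  filter_upwards [h.filter_mono nhdsWithin_le_nhds, hn.filter_mono nhdsWithin_le_nhds,
    self_mem_nhdsWithin] with x hx hx1 hx0
  refine hx.trans ?_
  have hpos : 0 < ‖x‖ := norm_pos_iff.2 hx0
  have h1 : 1 ≤ (‖x‖ ^ (m ^ 2))⁻¹ :=
    one_le_inv_iff₀.2 ⟨by positivity, pow_le_one₀ (norm_nonneg _) hx1.le⟩
  simp only [seriesTerm, Pi.mul_apply, Finset.prod_apply, norm_mul, Finset.prod_const,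
    Finset.card_range, norm_inv, norm_pow x, Pi.pow_apply]
  refine mul_le_mul_of_nonneg_right ?_ (by simp)
  exact le_mul_of_one_le_right (by positivity) h1

theorem MeromorphicAt.exists_pow_mul_norm_le {G : ℂ → ℂ} (hG : MeromorphicAt G 0) :
    ∃ (N : ℕ) (C : ℝ), ∀ᶠ x in 𝓝 0, ‖x‖ ^ N * ‖G x‖ ≤ C := by
  obtain ⟨N, hN⟩ := hG
  refine ⟨N, ‖(0 - 0 : ℂ) ^ N • G 0‖ + 1, ?_⟩
  filter_upwards [hN.continuousAt.norm.eventually_le_const (lt_add_one _)] with x hx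
  simpa [norm_smul] using hx

theorem seriesTerm_meromorphicAt {φ : ℂ → ℂ} (hφ : AnalyticAt ℂ φ 0) (m : ℕ) :
    MeromorphicAt (fun x => seriesTerm m (x, φ x)) 0 := by
  have h1 : AnalyticAt ℂ (fun x => ((3 : ℂ) ^ (4 * m ^ 3))⁻¹ *
      (∏ j ∈ Finset.Icc 1 m, (φ x - (2 / 3 * x) ^ j))) 0 := by fun_prop
  have h2 : AnalyticAt ℂ (fun x : ℂ => x ^ (m ^ 2)) 0 := by fun_prop
  exact (h1.meromorphicAt.mul h2.meromorphicAt.inv).mul (hφ.pow m).meromorphicAt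

/-- Along a fixed graph the terms acquire poles of arbitrarily high order. -/
theorem seriesTerm_growth {φ : ℂ → ℂ} {l m₀ A : ℕ} {κ K C : ℝ} (hκ : 0 < κ) (hC : 0 < C)
    (hφ : ∀ᶠ x in 𝓝 0, κ * ‖x‖ ^ l ≤ ‖φ x‖ ∧ ‖φ x‖ ≤ K * ‖x‖ ^ l) (hm₀ : l ≤ m₀)
    (hlow : ∀ᶠ x in 𝓝[≠] 0, C * ‖x‖ ^ A ≤ ‖seriesTerm m₀ (x, φ x)‖) (d : ℕ) :
    ∃ D : ℝ, 0 < D ∧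
      ∀ᶠ x in 𝓝[≠] 0, D * ‖x‖ ^ A ≤ ‖x‖ ^ d * ‖seriesTerm (d + m₀) (x, φ x)‖ := by
  induction d with
  | zero => exact ⟨C, hC, by simpa using hlow⟩
  | succ d ih =>
    obtain ⟨D, hD, h⟩ := ih
    have hn := eventually_norm_lt_one
    set m := d + m₀
    refine ⟨κ ^ 2 / 2 * (3 ^ (4 * (3 * m ^ 2 + 3 * m + 1)))⁻¹ * D, by positivity, ?_⟩
    filter_upwards [h, hn.filter_mono nhdsWithin_le_nhds, self_mem_nhdsWithin,
      (seriesTerm_ratio_bounds hκ hφ).filter_mono nhdsWithin_le_nhds] with x hx hx1 hx0 hr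
    have hpos : 0 < ‖x‖ := norm_pos_iff.2 hx0
    have hr := (hr m (by omega)).1
    have hq := le_mul_termRatio (l := l) (m := m) (by omega) hpos hx1.le
    rw [show d + 1 + m₀ = m + 1 by omega]
    have hq0 : 0 ≤ termRatio l m ‖x‖ := by unfold termRatio; positivity
    calc _ = κ ^ 2 / 2 * (3 ^ (4 * (3 * m ^ 2 + 3 * m + 1)))⁻¹ * (D * ‖x‖ ^ A) := by ring
      _ ≤ κ ^ 2 / 2 * (‖x‖ * termRatio l m ‖x‖) * (‖x‖ ^ d * ‖seriesTerm m (x, φ x)‖) := by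
        gcongr
      _ = ‖x‖ ^ (d + 1) * (κ ^ 2 / 2 * termRatio l m ‖x‖ * ‖seriesTerm m (x, φ x)‖) := by ring
      _ ≤ _ := by gcongr

/-- The series has an essential singularity at `0` along every graph other than `z = 0` and
`z = (2x/3)^k`. -/
theorem not_meromorphicAt_seriesSum {φ : ℂ → ℂ} (hφ : AnalyticAt ℂ φ 0)
    (h0 : ¬ ∀ᶠ x in 𝓝 0, φ x = 0)
    (hk : ∀ k : ℕ, 1 ≤ k → ¬ ∀ᶠ x in 𝓝 0, φ x = (2 / 3 * x) ^ k) :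
    ¬ MeromorphicAt (fun x => seriesSum (x, φ x)) 0 := by
  intro hmer
  obtain ⟨l, κ, K, hκ, hK, hb⟩ := hφ.exists_norm_bounds h0
  have hb3 := tendsto_pow_atTop_atTop_of_one_lt (show (1 : ℝ) < 3 by norm_num)
  -- Beyond `s`, the powers `3^i` absorb the constants of the ratio bounds with a factor `4` to
  -- spare, and `le_termRatio_peak` applies.
  obtain ⟨s, hs⟩ := (((hb3.eventually_ge_atTop (4 * (K * (K + 1)))).and
    (hb3.eventually_ge_atTop (4 * (κ ^ 2 / 2)⁻¹))).and
      (eventually_ge_atTop (12 * l ^ 2))).exists_forall_of_atTop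
  set M := l + s with hM
  -- Only the tail has controlled quotients; the finitely many terms removed are meromorphic.
  set G : ℂ → ℂ := fun x => ∑' i, seriesTerm (i + (M + 1)) (x, φ x) with hGdef
  have hGmer : MeromorphicAt G 0 := by
    have hfin : MeromorphicAt
        (fun x => ∑ i ∈ Finset.range M, seriesTerm (i + 1) (x, φ x)) 0 :=
      MeromorphicAt.fun_sum fun i _ => seriesTerm_meromorphicAt hφ (i + 1)
    refine (hmer.sub hfin).congr ?_
    filter_upwards [self_mem_nhdsWithin] with x hx
    have hsum : Summable fun n => seriesTerm (n + 1) (x, φ x) := summable_seriesTerm hx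
    have := hsum.sum_add_tsum_nat_add M
    simp only [Pi.sub_apply, hGdef, seriesSum, ← this]
    simp [add_assoc]
  obtain ⟨N, C, hC⟩ := hGmer.exists_pow_mul_norm_le
  obtain ⟨B, A, hB, hlow⟩ := seriesTerm_hasPowerLowerBound hφ h0 hk (M + 1)
  -- `N` pole orders defeat the bound on `G`, `A` offset the zero allowed in `hlow`, and one more
  -- leaves a spare factor `ρ j → 0`.
  obtain ⟨D, hD, hgrow⟩ := seriesTerm_growth hκ hB hb (by omega) hlow (A + N + 1)
  -- The radius at which term `n = j + (M + 1)`, that is `t j`, is the peak.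
  set ρ : ℕ → ℝ := fun j => (3 ^ (6 * (j + (M + 1) + l)))⁻¹ with hρ
  have hρ0 : ∀ j, 0 < ρ j := fun j => by positivity
  have hρlim : Tendsto ρ atTop (𝓝 0) := by
    refine (hb3.comp ?_).inv_tendsto_atTop
    exact tendsto_atTop_mono (fun j => by simp only [id]; omega) tendsto_id
  have hxlim : Tendsto (fun j => (ρ j : ℂ)) atTop (𝓝[≠] 0) := by
    refine tendsto_nhdsWithin_iff.2 ⟨?_, Eventually.of_forall fun j => ?_⟩
    · simpa [Function.comp_def] using (Complex.continuous_ofReal.tendsto 0).comp hρlim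
    · simpa using (hρ0 j).ne'
  have hsmall : ∀ᶠ j in atTop, 3 * C * ρ j < D := by
    have := hρlim.const_mul (3 * C)
    rw [mul_zero] at this
    exact this.eventually_lt_const hD
  obtain ⟨j, ⟨⟨⟨hj1, hj2⟩, hj3⟩, hj4⟩, hj5⟩ := ((((hxlim.eventually
    (hC.filter_mono nhdsWithin_le_nhds)).and (hxlim.eventually hgrow)).and (hxlim.eventually
      ((seriesTerm_ratio_bounds hκ hb).filter_mono nhdsWithin_le_nhds))).and hsmall).and
        (eventually_ge_atTop (A + N + 1)) |>.exists
  have hnorm : ‖(ρ j : ℂ)‖ = ρ j := by simp [abs_of_pos (hρ0 j)]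
  rw [hnorm] at hj1 hj2 hj3
  set t : ℕ → ℂ := fun i => seriesTerm (i + (M + 1)) ((ρ j : ℂ), φ (ρ j)) with ht
  have hup : ∀ i < j, 4 * ‖t i‖ ≤ ‖t (i + 1)‖ := by
    intro i hi
    have h := (hj3 (i + (M + 1)) (by omega)).1
    have hidx : i + (M + 1) = l + (i + s + 1) := by omega
    have hq : 3 ^ (i + s + 1) ≤ termRatio l (i + (M + 1)) (ρ j) := by
      rw [hidx]
      exact le_termRatio_peak (by omega) (hs _ (by omega)).2
    have h4 := (hs (i + s + 1) (by omega)).1.2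
    rw [← div_eq_mul_inv, div_le_iff₀ (by positivity)] at h4
    have : 4 ≤ κ ^ 2 / 2 * termRatio l (i + (M + 1)) (ρ j) := by
      rw [mul_comm]
      exact h4.trans (by gcongr)
    simp only [ht]
    rw [show i + 1 + (M + 1) = i + (M + 1) + 1 by ring]
    exact (mul_le_mul_of_nonneg_right this (norm_nonneg _)).trans h
  have hdown : ∀ i, j ≤ i → 4 * ‖t (i + 1)‖ ≤ ‖t i‖ := by
    intro i hi
    have h := (hj3 (i + (M + 1)) (by omega)).2
    have hidx : i + (M + 1) = l + (i + s + 1) := by omega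
    have hq : termRatio l (i + (M + 1)) (ρ j) ≤ (3 ^ (i + s + 1))⁻¹ := by
      rw [hidx]
      exact termRatio_peak_le (by omega)
    have h4 := (hs (i + s + 1) (by omega)).1.1
    have : 4 * (K * (K + 1) * termRatio l (i + (M + 1)) (ρ j)) ≤ 1 := by
      calc _ ≤ 4 * (K * (K + 1) * (3 ^ (i + s + 1))⁻¹) := by gcongr
        _ = 4 * (K * (K + 1)) / 3 ^ (i + s + 1) := by ring
        _ ≤ 1 := (div_le_one (by positivity)).2 h4
    simp only [ht]
    rw [show i + 1 + (M + 1) = i + (M + 1) + 1 by ring]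
    calc _ ≤ 4 * (K * (K + 1) * termRatio l (i + (M + 1)) (ρ j) *
          ‖seriesTerm (i + (M + 1)) ((ρ j : ℂ), φ (ρ j))‖) := by gcongr
      _ = 4 * (K * (K + 1) * termRatio l (i + (M + 1)) (ρ j)) *
          ‖seriesTerm (i + (M + 1)) ((ρ j : ℂ), φ (ρ j))‖ := by ring
      _ ≤ _ := mul_le_of_le_one_left (norm_nonneg _) this
  have hpeak : ‖t j‖ ≤ 3 * ‖G (ρ j)‖ := norm_le_three_mul_norm_tsum_of_peak hup hdown
  have hmono : ‖t (A + N + 1)‖ ≤ ‖t j‖ := by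
    refine Nat.decreasingInduction' (P := fun i => ‖t i‖ ≤ ‖t j‖) ?_ hj5 le_rfl
    intro i hi _ h
    have := hup i hi
    have := norm_nonneg (t i)
    linarith
  have hfinal : D * ρ j ^ A ≤ 3 * C * ρ j * ρ j ^ A := by
    calc _ ≤ ρ j ^ (A + N + 1) * ‖t (A + N + 1)‖ := hj2
      _ ≤ ρ j ^ (A + N + 1) * (3 * ‖G (ρ j)‖) :=
        mul_le_mul_of_nonneg_left (hmono.trans hpeak) (pow_nonneg (hρ0 j).le _)
      _ = 3 * (ρ j ^ N * ‖G (ρ j)‖) * (ρ j * ρ j ^ A) := by ring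
      _ ≤ 3 * C * (ρ j * ρ j ^ A) := by
        refine mul_le_mul_of_nonneg_right (by linarith) ?_
        have := hρ0 j
        positivity
      _ = _ := by ring
  have := le_of_mul_le_mul_right hfinal (pow_pos (hρ0 j) A)
  linarith

/-! ### Countably many graphs against an open image -/

/-- The graphs over a disk along which the series extends meromorphically. -/
theorem eqOn_of_extendsMeromorphicallyAlong {r : ℝ} (hr : 0 < r) {φ : ℂ → ℂ}
    (hφ : DifferentiableOn ℂ φ (Metric.ball 0 r))
    (h : ExtendsMeromorphicallyAlong seriesSum (Metric.ball 0 r) φ) :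
    Set.EqOn φ 0 (Metric.ball 0 r) ∨
      ∃ k : ℕ, Set.EqOn φ (fun x => (2 / 3 * x) ^ k) (Metric.ball 0 r) := by
  have hmem : (0 : ℂ) ∈ Metric.ball (0 : ℂ) r := Metric.mem_ball_self hr
  have han : AnalyticOnNhd ℂ φ (Metric.ball 0 r) := hφ.analyticOnNhd Metric.isOpen_ball
  have hpre : IsPreconnected (Metric.ball (0 : ℂ) r) := (convex_ball 0 r).isPreconnected
  obtain ⟨g, hg, hgeq⟩ := h
  have hmer : MeromorphicAt (fun x => seriesSum (x, φ x)) 0 := by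
    refine (hg 0 hmem).congr ?_
    filter_upwards [self_mem_nhdsWithin,
      nhdsWithin_le_nhds (Metric.isOpen_ball.mem_nhds hmem)] with x hx hxr
    exact hgeq x hxr hx
  by_contra! hcon
  refine not_meromorphicAt_seriesSum (han 0 hmem) (fun h => hcon.1 ?_)
    (fun k _ h => hcon.2 k ?_) hmer
  · exact han.eqOn_of_preconnected_of_eventuallyEq analyticOnNhd_const hpre hmem h
  · refine han.eqOn_of_preconnected_of_eventuallyEq (fun x _ => ?_) hpre hmem h
    fun_prop

/-- A holomorphic map between surfaces which has rank two at a point covers a neighbourhood of the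
image of that point. -/
theorem ContMDiff.range_mem_nhds {X : Type*} [TopologicalSpace X] [ChartedSpace (ℂ × ℂ) X]
    {Φ : X → ℂ × ℂ} (hΦ : ContMDiff 𝓘(ℂ, ℂ × ℂ) 𝓘(ℂ, ℂ × ℂ) ω Φ) {x : X}
    (hx : Function.Surjective (mfderiv 𝓘(ℂ, ℂ × ℂ) 𝓘(ℂ, ℂ × ℂ) Φ x)) :
    Set.range Φ ∈ 𝓝 (Φ x) := by
  have hd : MDifferentiableAt 𝓘(ℂ, ℂ × ℂ) 𝓘(ℂ, ℂ × ℂ) Φ x :=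
    (hΦ x).mdifferentiableAt (by simp)
  have hc := (contMDiffAt_iff.1 (hΦ x)).2
  set x' := extChartAt 𝓘(ℂ, ℂ × ℂ) x x
  set F : ℂ × ℂ → ℂ × ℂ := Φ ∘ (extChartAt 𝓘(ℂ, ℂ × ℂ) x).symm with hF
  have hcF : ContDiffAt ℂ ω F x' := by
    have hc' : ContDiffWithinAt ℂ ω F (Set.range 𝓘(ℂ, ℂ × ℂ)) x' := hc
    rwa [ModelWithCorners.range_eq_univ, contDiffWithinAt_univ] at hc'
  have hxF : Function.Surjective (fderiv ℂ F x') := by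
    have hxw : Function.Surjective (fderivWithin ℂ
        F (Set.range 𝓘(ℂ, ℂ × ℂ)) x') :=
      hd.mfderiv ▸ hx
    rwa [ModelWithCorners.range_eq_univ, fderivWithin_univ] at hxw
  have hmap := (hcF.hasStrictFDerivAt (by simp)).map_nhds_eq_of_surj
    (LinearMap.range_eq_top.2 hxF)
  have hFx : F x' = Φ x := by simp [hF, x']
  rw [← hFx, ← hmap]
  exact Filter.mem_map.2 (Filter.univ_mem' fun y => ⟨_, rfl⟩)

theorem mainTheorem6 :
    -- the series converges normally on compact subsets of `ℂ* × ℂ`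
    (∀ K : Set (ℂ × ℂ), IsCompact K → K ⊆ ringDomain →
      ∃ u : ℕ → ℝ, Summable u ∧ ∀ n : ℕ, ∀ p ∈ K, ‖seriesTerm (n + 1) p‖ ≤ u n) ∧
    -- its sum is holomorphic there
    DifferentiableOn ℂ seriesSum ringDomain ∧
    -- and extends holomorphically along every graph `z = (2x/3)^k`, `k ≥ 1`
    (∀ k : ℕ, 1 ≤ k →
      ExtendsHolomorphicallyAlong seriesSum Set.univ (fun x => (2 / 3 * x) ^ k)) ∧
    -- but along no one-parameter analytic family of graphs containing `z = 0`
    (∀ r : ℝ, 0 < r →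
      ∀ (X : Type*) [TopologicalSpace X] [T2Space X] [ChartedSpace (ℂ × ℂ) X]
        [IsManifold 𝓘(ℂ, ℂ × ℂ) ω X] (π : X → ℂ) (Φ : X → ℂ × ℂ) (φ : ℂ → ℂ → ℂ),
        IsOneParameterFamily r X π Φ φ →
        (∀ x ∈ Metric.ball (0 : ℂ) r, φ 0 x = 0) →
        ¬ ∀ α ∈ Metric.ball (0 : ℂ) 1,
          ExtendsMeromorphicallyAlong seriesSum (Metric.ball 0 r) (φ α)) := by
  refine ⟨seriesTerm_normal_convergence, differentiableOn_seriesSum, seriesSum_extends_along_pow,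
    ?_⟩
  intro r hr X _ _ _ _ π Φ φ hfam _ hext
  obtain ⟨x, hx⟩ := hfam.generic_rank
  have hnhds := hfam.holomorphic_map.range_mem_nhds hx
  set a := (Φ x).1
  -- the vertical line through `Φ x` meets only countably many of the graphs
  have hcount : {z : ℂ | (a, z) ∈ Set.range Φ}.Countable := by
    refine ((Set.countable_range fun k : ℕ => (2 / 3 * a) ^ k).insert 0).mono ?_
    rintro z ⟨y, hy⟩
    have hα := hfam.mapsTo y
    have hyim : Φ y ∈ Φ '' (π ⁻¹' {π y}) := ⟨y, rfl, rfl⟩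
    rw [hfam.image_fibre _ hα, hy] at hyim
    obtain ⟨ha, hz⟩ := hyim
    dsimp only at ha hz
    rcases eqOn_of_extendsMeromorphicallyAlong hr (hfam.holomorphic_graph _ hα) (hext _ hα) with
      h | ⟨k, h⟩
    · exact Or.inl (by rw [hz, h ha]; rfl)
    · exact Or.inr ⟨k, by rw [hz, h ha]⟩
  have hopen : {z : ℂ | (a, z) ∈ Set.range Φ} ∈ 𝓝 (Φ x).2 := by
    have hcont : ContinuousAt (fun z : ℂ => (a, z)) (Φ x).2 := by fun_prop
    exact hcont hnhds
  -- A countable subset of `ℂ` has dense complement, so it is no neighbourhood of a point.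
  obtain ⟨z, hz, hz'⟩ := mem_closure_iff_nhds.1 (hcount.dense_compl ℂ (Φ x).2) _ hopen
  exact hz' hz
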